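/- Let $q$ be a power of $2$ and let $PG(2,q)$ be the Desarguesian projective plane over $\mathbb{F}_q$, with homogeneous coordinates $(X_1,X_2,X_3)$. A $k$-arc is a set of $k$ points, no three of which are collinear; a secant of a $k$-arc $\mathcal{K}$ is a line containing two points of $\mathcal{K}$. A blocking set of the secants of $\mathcal{K}$ is a set of points of $PG(2,q)\setminus\mathcal{K}$ meeting every secant of $\mathcal{K}$; it is of minimum size if it has exactly $k-1$ points, and it is linear if it is contained in a line. Two point sets are projectively equivalent if some element of $PGL(3,q)$ maps one onto the other. For $\lambda,a_1,a_2\in\mathbb{F}_q$ with $\lambda\neq 0,1$ and $\{a_1,a_2,a_1+a_2\}\cap\{0,1,\lambda,\lambda+1\}=\emptyset$, let $\mathcal{K}'_{\lambda,a_1,a_2}=\mathcal{K}_0\cup\varphi(\mathcal{K}_0)$, where $\mathcal{K}_0=\{(0,0,1),(0,1,1),(1,0,1),(1,1,1)\}$ and $\varphi:(X_1,X_2,X_3)\mapsto(\lambda X_1+a_1X_3,\ \lambda X_2+a_2X_3,\ X_3)$. (1) Let $\mathcal{K}$ be a $k$-arc in $PG(2,q)$ with $k\le 10$. If there exists a non-linear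 blocking set of minimum size of the secants of $\mathcal{K}$, then $k=8$ and $\mathcal{K}$ is projectively equivalent to $\mathcal{K}'_{\lambda,a_1,a_2}$ for some $\lambda,a_1,a_2$ as above. (2) Equivalently, in terms of $1$-factorizations: let $3\le n\le 5$ and let $\mathcal{F}$ be a $1$-factorization of the complete graph $K_{2n}$ with vertex set $V$, that is, a set of pairwise edge-disjoint perfect matchings covering all edges. Let $\psi:V\sqcup\mathcal{F}\to PG(2,q)$ be an embedding of $\mathcal{F}$, that is, an injective map such that $\psi(i),\psi(j),\psi(k)$ are not collinear for any three distinct $i,j,k\in V$, and $\psi(F)$ is collinear with $\psi(i)$ and $\psi(j)$ for every $F\in\mathcal{F}$ and every edge $\{i,j\}$ of $F$. If the points $\psi(F)$, $F\in\mathcal{F}$, are not all on one line, then $n=4$ and $\psi(V)$ is projectively equivalent to $\mathcal{K}'_{\lambda,a_1,a_2}$ for some $\lambda,a_1,a_2$ as above. -/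

import Mathlib

open scoped LinearAlgebra.Projectivization MatrixGroups

namespace HyperfocusedArc

/-- The Desarguesian projective plane over `F`; it is `PG(2,q)` when `F` is finite of order `q`. -/
abbrev PG2 (F : Type*) [Field F] : Type _ := ℙ F (Fin 3 → F)

/-- A line of the plane: a projective subspace whose underlying vector space has dimension two. -/
def IsLine {F : Type*} [Field F] (L : Projectivization.Subspace F (Fin 3 → F)) : Prop :=
  Module.finrank F L.submodule = 2

/-- A `k`-arc: a set of `k` points no three of which are collinear. -/
def IsArc {F : Type*} [Field F] (k : ℕ) (K : Set (PG2 F)) : Prop :=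
  K.ncard = k ∧
    ∀ P ∈ K, ∀ Q ∈ K, ∀ R ∈ K, P ≠ Q → P ≠ R → Q ≠ R →
      ¬ Projectivization.IsCollinear ({P, Q, R} : Set (PG2 F))

/-- A secant of `K`: a line containing two distinct points of `K`. -/
def IsSecant {F : Type*} [Field F] (K : Set (PG2 F))
    (L : Projectivization.Subspace F (Fin 3 → F)) : Prop :=
  IsLine L ∧ ∃ P ∈ K, ∃ Q ∈ K, P ≠ Q ∧ P ∈ L ∧ Q ∈ L

/-- A blocking set of the secants of `K`: a point set outside `K` that meets every secant. -/
def IsBlockingSet {F : Type*} [Field F] (K B : Set (PG2 F)) : Prop :=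
  Disjoint B K ∧ ∀ L, IsSecant K L → ∃ P ∈ B, P ∈ L

/-- A blocking set of minimum size: it has `k - 1` points, where `k` is the size of `K`. -/
def IsMinimumBlockingSet {F : Type*} [Field F] (K B : Set (PG2 F)) : Prop :=
  IsBlockingSet K B ∧ B.ncard + 1 = K.ncard

/-- A linear point set: one contained in a line. -/
def IsLinear {F : Type*} [Field F] (B : Set (PG2 F)) : Prop :=
  ∃ L : Projectivization.Subspace F (Fin 3 → F), IsLine L ∧ ∀ P ∈ B, P ∈ L

/-- Projective equivalence: some element of `PGL(3, F)` maps `K` onto `K'`. -/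
def ProjEquiv {F : Type*} [Field F] (K K' : Set (PG2 F)) : Prop :=
  ∃ g : PGL(3, F), (fun P : PG2 F => g • P) '' K = K'

/-- The affine point with homogeneous coordinates `(a, b, 1)`. -/
def affinePoint {F : Type*} [Field F] (A : F × F) : PG2 F :=
  Projectivization.mk F ![A.1, A.2, 1] (fun h => one_ne_zero (congrFun h 2))

/-- The linear map `(X₁, X₂, X₃) ↦ (c X₁ + a₁ X₃, c X₂ + a₂ X₃, X₃)`. -/
def homologyLin {F : Type*} [Field F] (c a₁ a₂ : F) : (Fin 3 → F) →ₗ[F] (Fin 3 → F) where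
  toFun X := ![c * X 0 + a₁ * X 2, c * X 1 + a₂ * X 2, X 2]
  map_add' X Y := by
    ext i
    fin_cases i <;> simp <;> ring
  map_smul' t X := by
    ext i
    fin_cases i <;> simp <;> ring

theorem homologyLin_injective {F : Type*} [Field F] {c : F} (hc : c ≠ 0) (a₁ a₂ : F) :
    Function.Injective (homologyLin c a₁ a₂) := by
  intro X Y h
  have h0 : c * X 0 + a₁ * X 2 = c * Y 0 + a₁ * Y 2 := congrFun h 0
  have h1 : c * X 1 + a₂ * X 2 = c * Y 1 + a₂ * Y 2 := congrFun h 1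
  have h2 : X 2 = Y 2 := congrFun h 2
  rw [h2] at h0 h1
  ext i
  fin_cases i
  · exact mul_left_cancel₀ hc (add_right_cancel h0)
  · exact mul_left_cancel₀ hc (add_right_cancel h1)
  · exact h2

/-- The projectivity `(X₁, X₂, X₃) ↦ (c X₁ + a₁ X₃, c X₂ + a₂ X₃, X₃)`, where `c ≠ 0`. -/
def homology {F : Type*} [Field F] (c : F) (hc : c ≠ 0) (a₁ a₂ : F) : PG2 F → PG2 F :=
  Projectivization.map (homologyLin c a₁ a₂) (homologyLin_injective hc a₁ a₂)

/-- The four points `(0,0,1), (0,1,1), (1,0,1), (1,1,1)`. -/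
def baseArc (F : Type*) [Field F] : Set (PG2 F) :=
  affinePoint '' {((0 : F), (0 : F)), (0, 1), (1, 0), (1, 1)}

/-- The eight-point sets `K ∪ φ(K)`, where `K` is the base arc and `φ` is the homology with
parameters `c ≠ 0, 1` and `a₁, a₂` such that
`{a₁, a₂, a₁ + a₂} ∩ {0, 1, c, c + 1} = ∅`. -/
def IsHomologyArc {F : Type*} [Field F] (K' : Set (PG2 F)) : Prop :=
  ∃ (c a₁ a₂ : F) (hc : c ≠ 0), c ≠ 1 ∧
    ({a₁, a₂, a₁ + a₂} : Set F) ∩ {0, 1, c, c + 1} = ∅ ∧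
    K' = baseArc F ∪ homology c hc a₁ a₂ '' baseArc F

/-- A `1`-factorization of the complete graph on `V`: a set of `1`-factors (perfect matchings)
with pairwise disjoint edge sets which together cover all edges. -/
def IsOneFactorization {V : Type*} (𝓕 : Set (SimpleGraph.completeGraph V).Subgraph) : Prop :=
  (∀ M ∈ 𝓕, M.IsPerfectMatching) ∧
  (∀ M ∈ 𝓕, ∀ N ∈ 𝓕, M ≠ N → Disjoint M.edgeSet N.edgeSet) ∧
  (∀ e ∈ (SimpleGraph.completeGraph V).edgeSet, ∃ M ∈ 𝓕, e ∈ M.edgeSet)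

/-- An embedding of a `1`-factorization in the plane: an injective map on vertices and factors
such that no three vertices have collinear images and the image of each factor is collinear with
the images of the two ends of each of its edges. -/
def IsEmbedding {F : Type*} [Field F] {V : Type*} (𝓕 : Set (SimpleGraph.completeGraph V).Subgraph)
    (ψ : V ⊕ 𝓕 → PG2 F) : Prop :=
  Function.Injective ψ ∧
  (∀ i j k : V, i ≠ j → i ≠ k → j ≠ k →
    ¬ Projectivization.IsCollinear
      ({ψ (Sum.inl i), ψ (Sum.inl j), ψ (Sum.inl k)} : Set (PG2 F))) ∧
  (∀ (M : 𝓕) (i j : V), M.1.Adj i j →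
    Projectivization.IsCollinear
      ({ψ (Sum.inr M), ψ (Sum.inl i), ψ (Sum.inl j)} : Set (PG2 F)))

end HyperfocusedArc

/-!
Let `K` be an arc of `k ≤ 10` points and let `B` be a blocking set of its secants with `k - 1`
points, not all on a line; the field has characteristic two. The `k - 1` secants through a point
of `K` meet `B` in distinct points, so every point of `B` induces a perfect matching of `K`, and
together these matchings form a `1`-factorization (`exists_isFactoredArc`). The statement about
embedded `1`-factorizations is therefore a case of the one about blocking sets
(`IsEmbedding.isMinimumBlockingSet`).

No classification of `1`-factorizations is needed, because the situation can be linearised. Choose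
vectors `v i` for the points of `K` and `b R` for the points of `B`. For an edge `ij` of the factor
`R`, the product of `det (v i, v j, b S)` over the factors `S ≠ R` can be evaluated from either end
of the edge, as in Segre's lemma of tangents. Comparing the results shows that the `v i` can be
rescaled to vectors `u i` such that `b R` is proportional to `u i + u j` for every edge `ij` of `R`
(`IsFactoredArc.exists_scaling`).

A linear functional `φ` now vanishes at `b R` exactly when `φ ∘ u` is constant on the edges of `R`,
so if the line `φ = 0` contains `t` points of `B`, then all fibres of `φ ∘ u` have `t + 1`
elements. Hence `t + 1` divides `k`; it is even if `t > 0`, since a factor on the line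
matches the elements of each fibre; and it is less than `k`, since `B` is not on the line. A line
through two points of `B` has `t + 1 ≥ 4`, which for `k ≤ 10` leaves only `k = 8` and `t = 3`. The
fibres of size four then have the form `{u i, u j, u l, u i + u j + u l}`
(`IsFactoredArc.card_eq_eight_and_exists_add`), so the vectors `u i` form a coset of an additive
group of order eight spanned by three linearly independent vectors. In suitable coordinates they are
the vectors `(a, b, 1)` and `(p + a, q + b, r)` with `a, b ∈ {0, 1}`, which represent the union of
the base arc and its image under the homology with parameters `1 / r`, `p / r`, `q / r`
(`exists_projEquiv_isHomologyArc`).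
-/

namespace HyperfocusedArc

/-! ### Determinants of three vectors -/

section Vectors

variable {F : Type*} [Field F]

/-- The determinant of three vectors of `F³`, linear in the third vector. Its vanishing says that
the three corresponding points of the plane are collinear. -/
def triple (x y : Fin 3 → F) : (Fin 3 → F) →ₗ[F] F where
  toFun z := x 0 * (y 1 * z 2 - y 2 * z 1) - x 1 * (y 0 * z 2 - y 2 * z 0) +
    x 2 * (y 0 * z 1 - y 1 * z 0)
  map_add' z z' := by simp only [Pi.add_apply]; ring
  map_smul' t z := by simp only [Pi.smul_apply, smul_eq_mul, RingHom.id_apply]; ring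

theorem triple_apply (x y z : Fin 3 → F) :
    triple x y z = x 0 * (y 1 * z 2 - y 2 * z 1) - x 1 * (y 0 * z 2 - y 2 * z 0) +
      x 2 * (y 0 * z 1 - y 1 * z 0) := rfl

theorem triple_self_left (x y : Fin 3 → F) : triple x y x = 0 := by
  rw [triple_apply]; ring

theorem triple_self_right (x y : Fin 3 → F) : triple x y y = 0 := by
  rw [triple_apply]; ring

theorem triple_swap (x y z : Fin 3 → F) : triple y x z = -triple x y z := by
  simp only [triple_apply]; ring

theorem triple_swap_right (x y z : Fin 3 → F) : triple x z y = -triple x y z := by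
  simp only [triple_apply]; ring

theorem triple_rotate (x y z : Fin 3 → F) : triple x y z = triple y z x := by
  simp only [triple_apply]; ring

theorem triple_smul (r s t : F) (x y z : Fin 3 → F) :
    triple (r • x) (s • y) (t • z) = r * s * t * triple x y z := by
  simp only [triple_apply, Pi.smul_apply, smul_eq_mul]; ring

theorem triple_eq_det (x y z : Fin 3 → F) : triple x y z = (Matrix.of ![x, y, z]).det := by
  rw [Matrix.det_fin_three, triple_apply]
  simp only [Matrix.of_apply, Matrix.cons_val]
  ring

theorem triple_ne_zero_iff_linearIndependent {x y z : Fin 3 → F} :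
    triple x y z ≠ 0 ↔ LinearIndependent F ![x, y, z] := by
  rw [triple_eq_det, ← isUnit_iff_ne_zero, ← Matrix.isUnit_iff_isUnit_det,
    ← Matrix.linearIndependent_rows_iff_isUnit]
  rfl

theorem eq_zero_of_triple_ne_zero {x y z : Fin 3 → F} (h : triple x y z ≠ 0) {r s t : F}
    (hz : r • x + s • y + t • z = 0) : r = 0 ∧ s = 0 ∧ t = 0 := by
  have hli : LinearIndependent F ![x, y, z] := triple_ne_zero_iff_linearIndependent.1 h
  have h' := Fintype.linearIndependent_iff.1 hli ![r, s, t]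
    (by simpa [Fin.sum_univ_three] using hz)
  exact ⟨h' 0, h' 1, h' 2⟩

theorem exists_of_triple_eq_zero {x y z : Fin 3 → F} (h : triple x y z = 0) :
    ∃ r s t : F, r • x + s • y + t • z = 0 ∧ ¬ (r = 0 ∧ s = 0 ∧ t = 0) := by
  have h' : ¬ LinearIndependent F ![x, y, z] := fun hli =>
    triple_ne_zero_iff_linearIndependent.2 hli h
  rw [Fintype.not_linearIndependent_iff] at h'
  obtain ⟨g, hg, i, hi⟩ := h'
  refine ⟨g 0, g 1, g 2, by simpa [Fin.sum_univ_three] using hg, ?_⟩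
  rintro ⟨h0, h1, h2⟩
  fin_cases i <;> contradiction

theorem exists_eq_of_triple_eq_zero {x y z : Fin 3 → F}
    (hxy : ∀ s t : F, s • x + t • y = 0 → s = 0 ∧ t = 0) (h : triple x y z = 0) :
    ∃ s t : F, z = s • x + t • y := by
  obtain ⟨a, b, c, habc, hne⟩ := exists_of_triple_eq_zero h
  have hc : c ≠ 0 := by
    rintro rfl
    have := hxy a b (by simpa using habc)
    exact hne ⟨this.1, this.2, rfl⟩
  refine ⟨-(c⁻¹ * a), -(c⁻¹ * b), ?_⟩
  have h1 : c⁻¹ • (a • x + b • y + c • z) = 0 := by rw [habc, smul_zero]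
  rw [smul_add, smul_add, inv_smul_smul₀ hc] at h1
  linear_combination (norm := module) h1

end Vectors

/-! ### Rescaling the representatives of an arc -/

section Factorization

variable {F : Type*} [Field F] {ι β : Type*}

/-- A family `v` of vectors of `F³` representing the points of an arc, with a `1`-factorization of
the complete graph on its index set. The factors are indexed by `β`; the factor `R` is encoded by
the fixed-point-free involution `m R` that sends a vertex to its partner. -/
structure IsFactoredArc (v : ι → Fin 3 → F) (m : β → ι → ι) : Prop where
  triple_ne_zero : ∀ i j l, i ≠ j → i ≠ l → j ≠ l → triple (v i) (v j) (v l) ≠ 0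
  pair_indep : ∀ i j, i ≠ j → ∀ s t : F, s • v i + t • v j = 0 → s = 0 ∧ t = 0
  partner_partner : ∀ R i, m R (m R i) = i
  partner_ne : ∀ R i, m R i ≠ i
  existsUnique_factor : ∀ i j, i ≠ j → ∃! R, m R i = j

namespace IsFactoredArc

variable {v : ι → Fin 3 → F} {m : β → ι → ι}

theorem injective (h : IsFactoredArc v m) : Function.Injective v := by
  intro i j hij
  by_contra hne
  have := h.pair_indep i j hne 1 (-1) (by simp [hij])
  exact one_ne_zero this.1

theorem partner_left_cancel (h : IsFactoredArc v m) {R S : β} {i : ι} (he : m R i = m S i) :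
    R = S :=
  (h.existsUnique_factor i (m S i) (h.partner_ne S i).symm).unique he rfl

theorem smul (h : IsFactoredArc v m) {A : ι → F} (hA : ∀ i, A i ≠ 0) :
    IsFactoredArc (fun i => A i • v i) m where
  triple_ne_zero i j l h1 h2 h3 := by
    rw [triple_smul]
    exact mul_ne_zero (mul_ne_zero (mul_ne_zero (hA i) (hA j)) (hA l))
      (h.triple_ne_zero i j l h1 h2 h3)
  pair_indep i j hij s t hst := by
    have := h.pair_indep i j hij (s * A i) (t * A j) (by simpa [mul_smul] using hst)
    simpa [hA] using this
  partner_partner := h.partner_partner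
  partner_ne := h.partner_ne
  existsUnique_factor := h.existsUnique_factor

/-- The product over all factors but one, taken at one of the two ends of an edge of that factor,
runs over all vertices off that edge. -/
theorem prod_erase_factor [Fintype ι] [Fintype β] [DecidableEq ι] [DecidableEq β]
    (h : IsFactoredArc v m) (R : β) (i : ι) (f : ι → F) :
    ∏ S ∈ Finset.univ.erase R, f (m S i) =
      ∏ l ∈ (Finset.univ.erase i).erase (m R i), f l := by
  refine Finset.prod_bij (fun S _ => m S i) ?_ ?_ ?_ ?_
  · intro S hS
    simp only [Finset.mem_erase, Finset.mem_univ, and_true] at hS ⊢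
    exact ⟨fun he => hS (h.partner_left_cancel he), h.partner_ne S i⟩
  · intro S _ S' _ he
    exact h.partner_left_cancel he
  · intro l hl
    simp only [Finset.mem_erase, Finset.mem_univ, and_true] at hl
    obtain ⟨S, hS, -⟩ := h.existsUnique_factor i l (Ne.symm hl.2)
    refine ⟨S, ?_, hS⟩
    simp only [Finset.mem_erase, Finset.mem_univ, and_true]
    rintro rfl
    exact hl.1 hS.symm
  · intros; rfl

/-- In the manner of Segre's lemma of tangents: the representatives of the points of the arc can be
rescaled so that the point of a factor on the secant `ij` is the *sum* of the two
representatives. The product of `triple (v i) (v j) (b S)` over the other factors `S` can be computed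
from the end `i` or from the end `j`, and comparing the two determines the ratio of the coefficients
of `b R` on the edge `ij`. -/
theorem exists_scaling [Finite ι] [Finite β] [CharP F 2] (h : IsFactoredArc v m)
    {b : β → Fin 3 → F}
    (hb : ∀ R i, ∃ x y : F, x ≠ 0 ∧ y ≠ 0 ∧ b R = x • v i + y • v (m R i)) :
    ∃ A : ι → F, (∀ i, A i ≠ 0) ∧
      ∀ R i, ∃ s : F, s ≠ 0 ∧ b R = s • (A i • v i + A (m R i) • v (m R i)) := by
  classical
  have := Fintype.ofFinite ι
  have := Fintype.ofFinite β
  choose x y hx hy hxy using hb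
  refine ⟨fun i => (∏ R, y R i)⁻¹, fun i => inv_ne_zero (Finset.prod_ne_zero_iff.2
    fun R _ => hy R i), fun R i => ?_⟩
  set j := m R i with hj
  have hji : m R j = i := h.partner_partner R i
  have hne : j ≠ i := h.partner_ne R i
  -- The product over the factors other than `R`, computed from either end of the edge.
  have key (i j : ι) (hj : m R i = j) : ∏ S ∈ Finset.univ.erase R, triple (v i) (v j) (b S) =
      (∏ S ∈ Finset.univ.erase R, y S i) *
        ∏ l ∈ (Finset.univ.erase i).erase j, triple (v i) (v j) (v l) := by
    subst hj
    rw [← h.prod_erase_factor, ← Finset.prod_mul_distrib]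
    refine Finset.prod_congr rfl fun S _ => ?_
    rw [hxy S i, map_add, map_smul, map_smul, triple_self_left]
    simp
  have hswap (z : Fin 3 → F) : triple (v j) (v i) z = triple (v i) (v j) z := by
    rw [triple_swap, CharTwo.neg_eq]
  have hE : ∏ S ∈ Finset.univ.erase R, y S i = ∏ S ∈ Finset.univ.erase R, y S j := by
    have h1 := key i j hj.symm
    have h2 := key j i hji
    simp only [hswap] at h2
    rw [Finset.erase_right_comm, h1] at h2
    refine mul_right_cancel₀ (Finset.prod_ne_zero_iff.2 fun l hl => ?_) h2
    simp only [Finset.mem_erase, Finset.mem_univ, and_true] at hl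
    exact h.triple_ne_zero i j l hne.symm (Ne.symm hl.2) (Ne.symm hl.1)
  have hcoef : x R i = y R j := by
    have h1 := hxy R i
    rw [hxy R j, hji, ← hj] at h1
    have := h.pair_indep i j hne.symm (x R i - y R j) (y R i - x R j) (by
      rw [sub_smul, sub_smul]
      linear_combination (norm := module) -h1)
    exact sub_eq_zero.1 this.1
  have hE0 : ∏ S ∈ Finset.univ.erase R, y S j ≠ 0 := Finset.prod_ne_zero_iff.2 fun S _ => hy S j
  refine ⟨(∏ S ∈ Finset.univ.erase R, y S j) * y R i * y R j,
    mul_ne_zero (mul_ne_zero hE0 (hy R i)) (hy R j), ?_⟩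
  beta_reduce
  rw [← Finset.mul_prod_erase Finset.univ (fun S => y S i) (Finset.mem_univ R),
    ← Finset.mul_prod_erase Finset.univ (fun S => y S j) (Finset.mem_univ R), hE, smul_add,
    smul_smul, smul_smul, hxy R i, ← hj, hcoef]
  have hi := hy R i
  have hj' := hy R j
  congr 2 <;> field_simp

end IsFactoredArc

end Factorization

/-! ### Fibres of linear functionals on the arc -/

theorem even_card_of_involution {α : Type*} (s : Finset α) (f : α → α)
    (hmem : ∀ a ∈ s, f a ∈ s) (hinv : ∀ a, f (f a) = a) (hne : ∀ a, f a ≠ a) : Even s.card := by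
  have h : ∑ _a ∈ s, (1 : ZMod 2) = 0 :=
    Finset.sum_involution (fun a _ => f a) (fun _ _ => by decide) (fun a _ _ => hne a)
      hmem (fun a _ => hinv a)
  rw [Finset.sum_const, nsmul_eq_mul, mul_one] at h
  exact (ZMod.natCast_eq_zero_iff_even).1 h

section Fibres

variable {F : Type*} [Field F] [CharP F 2] {ι β : Type*} {u : ι → Fin 3 → F} {m : β → ι → ι}
  {b : β → Fin 3 → F}

theorem apply_factor_eq_zero_iff
    (hb : ∀ R i, ∃ s : F, s ≠ 0 ∧ b R = s • (u i + u (m R i))) (φ : (Fin 3 → F) →ₗ[F] F)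
    (R : β) (i : ι) : φ (b R) = 0 ↔ φ (u (m R i)) = φ (u i) := by
  obtain ⟨s, hs, hR⟩ := hb R i
  rw [hR, map_smul, map_add, smul_eq_mul, mul_eq_zero, or_iff_right hs, CharTwo.add_eq_zero, eq_comm]

namespace IsFactoredArc

variable [Fintype ι] [Fintype β] [DecidableEq F]

/-- A linear functional `φ` cuts out a line of the plane, carrying the points of some factors. All
fibres of `φ ∘ u` have one element more than the number of these factors: besides `i`, the fibre of
`i` consists of its partners in these factors. -/
theorem card_fibre (h : IsFactoredArc u m)
    (hb : ∀ R i, ∃ s : F, s ≠ 0 ∧ b R = s • (u i + u (m R i))) (φ : (Fin 3 → F) →ₗ[F] F) (i : ι) :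
    {j | φ (u j) = φ (u i)}.toFinset.card = {R | φ (b R) = 0}.toFinset.card + 1 := by
  classical
  have : {j | φ (u j) = φ (u i)}.toFinset =
      insert i ({R | φ (b R) = 0}.toFinset.image fun R => m R i) := by
    ext j
    simp only [Set.mem_toFinset, Set.mem_ofPred_eq, Finset.mem_insert, Finset.mem_image]
    constructor
    · intro hj
      by_cases hij : j = i
      · exact Or.inl hij
      · obtain ⟨R, rfl, -⟩ := h.existsUnique_factor i j (Ne.symm hij)
        exact Or.inr ⟨R, (apply_factor_eq_zero_iff hb φ R i).2 hj, rfl⟩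
    · rintro (rfl | ⟨R, hR, rfl⟩)
      · rfl
      · exact (apply_factor_eq_zero_iff hb φ R i).1 hR
  rw [this, Finset.card_insert_of_notMem, Finset.card_image_of_injective]
  · intro R S hRS
    exact h.partner_left_cancel hRS
  · simp only [Finset.mem_image, not_exists, not_and]
    exact fun R _ => h.partner_ne R i

theorem card_factors_add_one_dvd (h : IsFactoredArc u m)
    (hb : ∀ R i, ∃ s : F, s ≠ 0 ∧ b R = s • (u i + u (m R i))) (φ : (Fin 3 → F) →ₗ[F] F) :
    {R | φ (b R) = 0}.toFinset.card + 1 ∣ Fintype.card ι := by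
  rw [← Finset.card_univ, Finset.card_eq_sum_card_image (fun j => φ (u j)) Finset.univ]
  refine Finset.dvd_sum fun y hy => ?_
  obtain ⟨i, -, rfl⟩ := Finset.mem_image.1 hy
  rw [← h.card_fibre hb φ i]
  exact dvd_of_eq (congrArg _ (by ext; simp))

theorem even_card_factors_add_one (h : IsFactoredArc u m)
    (hb : ∀ R i, ∃ s : F, s ≠ 0 ∧ b R = s • (u i + u (m R i))) (φ : (Fin 3 → F) →ₗ[F] F)
    {R : β} (hR : φ (b R) = 0) (i : ι) : Even ({R | φ (b R) = 0}.toFinset.card + 1) := by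
  rw [← h.card_fibre hb φ i]
  refine even_card_of_involution _ (m R) (fun j hj => ?_) (h.partner_partner R) (h.partner_ne R)
  simp only [Set.mem_toFinset, Set.mem_ofPred_eq] at hj ⊢
  rw [← hj, ← apply_factor_eq_zero_iff hb φ R j]
  exact hR

theorem card_factors_add_one_lt (h : IsFactoredArc u m)
    (hb : ∀ R i, ∃ s : F, s ≠ 0 ∧ b R = s • (u i + u (m R i))) (φ : (Fin 3 → F) →ₗ[F] F)
    {R : β} (hR : φ (b R) ≠ 0) (i : ι) :
    {R | φ (b R) = 0}.toFinset.card + 1 < Fintype.card ι := by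
  rw [← h.card_fibre hb φ i]
  refine Finset.card_lt_univ_of_notMem (x := m R i) ?_
  simpa [← apply_factor_eq_zero_iff hb φ R i] using hR

/-- If the points of the factors are not collinear, the line joining the points of the factors of
`ij` and `il` splits the at most ten vertices into several fibres of the same even size at least
four. Hence there are eight vertices and the fibres have size four, and the fourth
member of the fibre of `i, j, l` is matched with `l` by the factor of `ij` and with `j` by the
factor of `il`; the two resulting proportionalities leave only the sum of the three vectors. -/
theorem card_eq_eight_and_exists_add (h : IsFactoredArc u m)
    (hb : ∀ R i, ∃ s : F, s ≠ 0 ∧ b R = s • (u i + u (m R i)))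
    (hlin : ∀ φ : (Fin 3 → F) →ₗ[F] F, φ ≠ 0 → ∃ R, φ (b R) ≠ 0) (hcard : Fintype.card ι ≤ 10)
    {i j l : ι} (hij : i ≠ j) (hil : i ≠ l) (hjl : j ≠ l) :
    Fintype.card ι = 8 ∧ ∃ p, u p = u i + u j + u l := by
  classical
  set φ := triple (u i + u j) (u i + u l) with hφ
  have hφi : φ (u i) = triple (u j) (u l) (u i) := by
    simp only [hφ, triple_apply, Pi.add_apply]; ring
  have hφ0 : φ ≠ 0 := by
    intro h0
    rw [h0] at hφi
    exact h.triple_ne_zero j l i hjl hij.symm hil.symm hφi.symm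
  have hφj : φ (u j) = φ (u i) := by
    rw [eq_comm, ← CharTwo.add_eq_zero, ← map_add]; exact triple_self_left _ _
  have hφl : φ (u l) = φ (u i) := by
    rw [eq_comm, ← CharTwo.add_eq_zero, ← map_add]; exact triple_self_right _ _
  obtain ⟨R, hR, -⟩ := h.existsUnique_factor i j hij
  obtain ⟨S, hS, -⟩ := h.existsUnique_factor i l hil
  have hRS : R ≠ S := by rintro rfl; exact hjl (hR.symm.trans hS)
  have hφR : φ (b R) = 0 := (apply_factor_eq_zero_iff hb φ R i).2 (by rw [hR, hφj])
  have hφS : φ (b S) = 0 := (apply_factor_eq_zero_iff hb φ S i).2 (by rw [hS, hφl])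
  obtain ⟨Q, hQ⟩ := hlin φ hφ0
  -- the line `φ = 0` carries the points of the distinct factors `R` and `S`
  have htwo : 2 ≤ {R | φ (b R) = 0}.toFinset.card := by
    rw [← Finset.card_pair hRS]
    refine Finset.card_le_card fun T hT => ?_
    rcases Finset.mem_insert.1 hT with rfl | hT
    · simpa using hφR
    · rw [Finset.mem_singleton.1 hT]; simpa using hφS
  have hlt := h.card_factors_add_one_lt hb φ hQ i
  have heven := h.even_card_factors_add_one hb φ hφR i
  obtain ⟨d, hd⟩ := h.card_factors_add_one_dvd hb φ
  have hfib := h.card_fibre hb φ i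
  generalize {R | φ (b R) = 0}.toFinset.card = t at *
  -- `t + 1` is even, at least `3`, and a proper divisor of a number at most `10`
  have hd2 : d = 2 := by
    obtain ⟨e, he⟩ := heven
    have : d ≠ 0 := by rintro rfl; omega
    have : d ≠ 1 := by rintro rfl; omega
    by_contra hne
    have : (t + 1) * 3 ≤ (t + 1) * d := Nat.mul_le_mul_left _ (by omega)
    omega
  subst hd2
  have ht : t = 3 := by
    obtain ⟨e, he⟩ := heven
    omega
  subst ht
  refine ⟨by omega, ?_⟩
  -- the partner of `l` in the factor of `ij` and the partner of `j` in the factor of `il`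
  have hRj : m R j = i := by rw [← hR, h.partner_partner]
  have hSl : m S l = i := by rw [← hS, h.partner_partner]
  have hp1 : φ (u (m R l)) = φ (u i) := by
    rw [(apply_factor_eq_zero_iff hb φ R l).1 hφR, hφl]
  have hp2 : φ (u (m S j)) = φ (u i) := by
    rw [(apply_factor_eq_zero_iff hb φ S j).1 hφS, hφj]
  have e1 : m R l ≠ i := fun he => hjl (by rw [← h.partner_partner R l, he, hR])
  have e2 : m R l ≠ j := fun he => hil (by rw [← h.partner_partner R l, he, hRj])
  have e3 : m R l ≠ l := h.partner_ne R l
  have e4 : m S j ≠ i := fun he => hjl (by rw [← h.partner_partner S j, he, hS])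
  have e5 : m S j ≠ j := h.partner_ne S j
  have e6 : m S j ≠ l := fun he => hij (by rw [← h.partner_partner S j, he, hSl])
  have hp : m S j = m R l := by
    by_contra hne
    have hsub : ({i, j, l, m R l, m S j} : Finset ι) ⊆ {j | φ (u j) = φ (u i)}.toFinset := by
      intro x hx
      simp only [Finset.mem_insert, Finset.mem_singleton] at hx
      rw [Set.mem_toFinset, Set.mem_ofPred_eq]
      rcases hx with rfl | rfl | rfl | rfl | rfl
      exacts [rfl, hφj, hφl, hp1, hp2]
    have h5 : ({i, j, l, m R l, m S j} : Finset ι).card = 5 := by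
      rw [Finset.card_insert_of_notMem, Finset.card_insert_of_notMem,
        Finset.card_insert_of_notMem, Finset.card_pair (Ne.symm hne)] <;>
      simp only [Finset.mem_insert, Finset.mem_singleton, not_or] <;> tauto
    have := Finset.card_le_card hsub
    omega
  refine ⟨m R l, ?_⟩
  obtain ⟨s₁, hs₁, hb₁⟩ := hb R i
  obtain ⟨s₂, hs₂, hb₂⟩ := hb R l
  obtain ⟨t₁, ht₁, hc₁⟩ := hb S i
  obtain ⟨t₂, ht₂, hc₂⟩ := hb S j
  rw [hR] at hb₁
  rw [hS] at hc₁
  rw [hp] at hc₂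
  have hl : u l + u (m R l) = (s₂⁻¹ * s₁) • (u i + u j) := by
    rw [mul_smul, ← hb₁, hb₂, inv_smul_smul₀ hs₂]
  have hj : u j + u (m R l) = (t₂⁻¹ * t₁) • (u i + u l) := by
    rw [mul_smul, ← hc₁, hc₂, inv_smul_smul₀ ht₂]
  generalize s₂⁻¹ * s₁ = s at hl
  generalize t₂⁻¹ * t₁ = t at hj
  have hz : (s - t) • u i + (s + 1) • u j + (-t - 1) • u l = 0 := by
    linear_combination (norm := module) hj - hl
  obtain ⟨-, hs, -⟩ := eq_zero_of_triple_ne_zero (h.triple_ne_zero i j l hij hil hjl) hz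
  rw [CharTwo.add_eq_zero] at hs
  rw [hs, one_smul] at hl
  have : u l + u l = 0 := by rw [← two_smul F, CharTwo.two_eq_zero, zero_smul]
  linear_combination (norm := module) hl - this

end IsFactoredArc

end Fibres

/-! ### The eight-point arcs in coordinates -/

section Cube

variable {F : Type*} [Field F]

/-- The eight vectors `(a, b, 1)` and `(p + a, q + b, r)` with `a, b ∈ {0, 1}`, where `true` and
`false` stand for `1` and `0` in the first two entries of the index, and the last entry tells the
two families apart. In characteristic two they form a coset of an additive subgroup. -/
def cubePoint (p q r : F) (t : Bool × Bool × Bool) : Fin 3 → F :=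
  ![cond t.2.2 p 0 + cond t.1 1 0, cond t.2.2 q 0 + cond t.2.1 1 0, cond t.2.2 r 1]

theorem cubePoint_injective {p q r : F} (hr : r ≠ 1) : Function.Injective (cubePoint p q r) := by
  rintro ⟨a, b, c⟩ ⟨a', b', c'⟩ h
  have h0 := congrFun h 0
  have h1 := congrFun h 1
  have h2 := congrFun h 2
  have hr' := hr.symm
  simp only [cubePoint, Matrix.cons_val] at h0 h1 h2
  cases c <;> cases c' <;> simp_all <;>
  cases a <;> cases a' <;> simp_all <;> cases b <;> cases b' <;> simp_all

/-- The eight points of `cubePoint` are the base arc and its image under the homology with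
parameters `1 / r`, `p / r`, `q / r`. That no three of them are collinear is used for the conditions
on the parameters. -/
theorem isHomologyArc_of_cubePoint [CharP F 2] {p q r : F} (hr : r ≠ 1)
    (harc : ∀ s t w, s ≠ t → s ≠ w → t ≠ w →
      triple (cubePoint p q r s) (cubePoint p q r t) (cubePoint p q r w) ≠ 0)
    {K' : Set (PG2 F)}
    (hK' : ∀ P, P ∈ K' ↔ ∃ t, ∃ h : cubePoint p q r t ≠ 0, P = Projectivization.mk F _ h) :
    IsHomologyArc K' := by
  have h2 : (2 : F) = 0 := CharTwo.two_eq_zero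
  -- Each excluded relation between `p`, `q`, `r` makes three of the eight points collinear.
  have hr0 : r ≠ 0 := by
    have := harc (false, false, true) (true, false, true) (false, true, true)
      (by decide) (by decide) (by decide)
    simp [triple_apply, cubePoint] at this
    grind
  have p0 := harc (false, false, false) (false, true, false) (false, false, true)
    (by decide) (by decide) (by decide)
  have p1 := harc (false, false, false) (false, true, false) (true, false, true)
    (by decide) (by decide) (by decide)
  have p2 := harc (true, false, false) (true, true, false) (false, false, true)
    (by decide) (by decide) (by decide)
  have p3 := harc (true, false, false) (true, true, false) (true, false, true)
    (by decide) (by decide) (by decide)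
  have q0 := harc (false, false, false) (true, false, false) (false, false, true)
    (by decide) (by decide) (by decide)
  have q1 := harc (false, false, false) (true, false, false) (false, true, true)
    (by decide) (by decide) (by decide)
  have q2 := harc (false, true, false) (true, true, false) (false, false, true)
    (by decide) (by decide) (by decide)
  have q3 := harc (false, true, false) (true, true, false) (false, true, true)
    (by decide) (by decide) (by decide)
  have s0 := harc (false, false, false) (true, true, false) (false, false, true)
    (by decide) (by decide) (by decide)
  have s1 := harc (false, false, false) (true, true, false) (true, false, true)
    (by decide) (by decide) (by decide)
  have s2 := harc (true, false, false) (false, true, false) (false, false, true)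
    (by decide) (by decide) (by decide)
  have s3 := harc (true, false, false) (false, true, false) (true, false, true)
    (by decide) (by decide) (by decide)
  simp [triple_apply, cubePoint] at p0 p1 p2 p3 q0 q1 q2 q3 s0 s1 s2 s3
  have hp : p ≠ 0 ∧ p ≠ 1 ∧ p ≠ r ∧ p ≠ r + 1 := by
    refine ⟨?_, ?_, ?_, ?_⟩ <;> rintro rfl <;> grind
  have hq : q ≠ 0 ∧ q ≠ 1 ∧ q ≠ r ∧ q ≠ r + 1 := by
    refine ⟨?_, ?_, ?_, ?_⟩ <;> rintro rfl <;> grind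
  have hs : p + q ≠ 0 ∧ p + q ≠ 1 ∧ p + q ≠ r ∧ p + q ≠ r + 1 := by
    refine ⟨?_, ?_, ?_, ?_⟩ <;> intro he <;> grind
  have hscale (a b : F) (h) : homology r⁻¹ (inv_ne_zero hr0) (p / r) (q / r) (affinePoint (a, b)) =
      Projectivization.mk F ![p + a, q + b, r] h := by
    rw [homology, affinePoint, Projectivization.map_mk, Projectivization.mk_eq_mk_iff']
    refine ⟨r⁻¹, ?_⟩
    ext i
    fin_cases i <;> simp [homologyLin] <;> field_simp <;> ring
  have hdiv (a : F) (ha : a ≠ 0 ∧ a ≠ 1 ∧ a ≠ r ∧ a ≠ r + 1) :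
      a / r ∉ ({0, 1, r⁻¹, r⁻¹ + 1} : Set F) := by
    simp only [Set.mem_insert_iff, Set.mem_singleton_iff, not_or]
    refine ⟨div_ne_zero ha.1 hr0, ?_, ?_, ?_⟩ <;> intro he <;> field_simp at he
    · exact ha.2.2.1 he
    · exact ha.2.1 he
    · exact ha.2.2.2 (by rw [he]; ring)
  refine ⟨r⁻¹, p / r, q / r, inv_ne_zero hr0, by simpa using hr, ?_, ?_⟩
  · rw [Set.eq_empty_iff_forall_notMem]
    rintro x ⟨hx, hx'⟩
    rcases hx with rfl | rfl | rfl
    · exact hdiv p hp hx'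
    · exact hdiv q hq hx'
    · rw [← add_div] at hx'
      exact hdiv (p + q) hs hx'
  · ext P
    rw [hK']
    simp only [baseArc, Set.mem_union, Set.image_insert_eq, Set.image_singleton,
      Set.mem_insert_iff, Set.mem_singleton_iff, Prod.exists, Bool.exists_bool]
    have hne (a b : F) : ![p + a, q + b, r] ≠ 0 := fun h => hr0 (congrFun h 2)
    rw [hscale 0 0 (hne 0 0), hscale 0 1 (hne 0 1), hscale 1 0 (hne 1 0), hscale 1 1 (hne 1 1)]
    simp only [cubePoint, affinePoint, cond_true, cond_false, zero_add]
    have hne' (a b : F) : ![a, b, 1] ≠ 0 := fun h => one_ne_zero (congrFun h 2)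
    simp only [hne, hne', ne_eq, not_false_eq_true, exists_true_left]
    tauto

end Cube

/-! ### Eight-point arcs closed under sums of three vectors -/

section Classification

variable {F : Type*} [Field F]

theorem triple_mulVec (N : Matrix (Fin 3) (Fin 3) F) (x y z : Fin 3 → F) :
    triple (N.mulVec x) (N.mulVec y) (N.mulVec z) = N.det * triple x y z := by
  simp only [triple_apply, Matrix.det_fin_three, Matrix.mulVec, dotProduct, Fin.sum_univ_three]
  ring

/-- Eight vectors in general position that contain the sum of any three of them, and are not
contained in an affine plane missing the origin, are in suitable coordinates those of `cubePoint`: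
`u i`, `u j`, `u l`, `u k` and the sums of three of these are eight distinct members. -/
theorem exists_projEquiv_isHomologyArc [CharP F 2] {ι : Type*} [Fintype ι] {u : ι → Fin 3 → F}
    (hinj : Function.Injective u) (hcard : Fintype.card ι = 8)
    (harc : ∀ i j l, i ≠ j → i ≠ l → j ≠ l → triple (u i) (u j) (u l) ≠ 0)
    (hadd : ∀ i j l, i ≠ j → i ≠ l → j ≠ l → ∃ p, u p = u i + u j + u l)
    {i j l k : ι} (hij : i ≠ j) (hil : i ≠ l) (hjl : j ≠ l)
    (hk : triple (u i + u j) (u i + u l) (u i + u k) ≠ 0) {K : Set (PG2 F)}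
    (hK : ∀ P, P ∈ K ↔ ∃ i, ∃ h : u i ≠ 0, P = Projectivization.mk F _ h) :
    ∃ K', IsHomologyArc K' ∧ ProjEquiv K K' := by
  have h2 : (2 : F) = 0 := CharTwo.two_eq_zero
  have hw : triple (u i + u j) (u i + u l) (u i) ≠ 0 := by
    have := harc j l i hjl hij.symm hil.symm
    convert this using 1
    simp only [triple_apply, Pi.add_apply]; ring
  have hik : i ≠ k := by
    rintro rfl
    apply hk
    rw [← two_smul F, h2, zero_smul, map_zero]
  have hjk : j ≠ k := by rintro rfl; exact hk (triple_self_left _ _)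
  have hlk : l ≠ k := by rintro rfl; exact hk (triple_self_right _ _)
  -- The change of coordinates for which `u i`, `u j`, `u l` become `(0,0,1)`, `(1,0,1)`, `(0,1,1)`.
  let M : Matrix (Fin 3) (Fin 3) F := (Matrix.of ![u i + u j, u i + u l, u i]).transpose
  have hM : M.det ≠ 0 := by rwa [Matrix.det_transpose, ← triple_eq_det]
  let N : GL (Fin 3) F := Matrix.GeneralLinearGroup.mkOfDetNeZero M hM
  have hNM (x : Fin 3 → F) : N • x = M.mulVec x := rfl
  have hN (x : Fin 3 → F) : N • x = x 0 • (u i + u j) + x 1 • (u i + u l) + x 2 • u i := by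
    rw [hNM]
    ext a
    simp only [M, Matrix.mulVec, dotProduct, Fin.sum_univ_three, Matrix.transpose_apply,
      Matrix.of_apply, Matrix.cons_val, Pi.add_apply, Pi.smul_apply, smul_eq_mul]
    ring
  let x : ι → Fin 3 → F := fun a => N⁻¹ • u a
  have hNx (a : ι) : N • x a = u a := smul_inv_smul N (u a)
  have hxeq {a : ι} {y : Fin 3 → F} (h : N • y = u a) : x a = y := by
    rw [← inv_smul_smul N y, h]
  have huu (y : Fin 3 → F) : y + y = 0 := by rw [← two_smul F, h2, zero_smul]
  have xi : x i = ![0, 0, 1] := hxeq (by rw [hN]; simp)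
  have xj : x j = ![1, 0, 1] := hxeq (by
    rw [hN]; simp only [Matrix.cons_val]
    linear_combination (norm := module) huu (u i))
  have xl : x l = ![0, 1, 1] := hxeq (by
    rw [hN]; simp only [Matrix.cons_val]
    linear_combination (norm := module) huu (u i))
  have xarc (a b c : ι) (h1 : a ≠ b) (h2 : a ≠ c) (h3 : b ≠ c) :
      triple (x a) (x b) (x c) ≠ 0 := by
    have := harc a b c h1 h2 h3
    rw [← hNx a, ← hNx b, ← hNx c, hNM, hNM, hNM, triple_mulVec] at this
    exact right_ne_zero_of_mul this
  have xadd (a b c : ι) (h1 : a ≠ b) (h2 : a ≠ c) (h3 : b ≠ c) : ∃ d, x d = x a + x b + x c := by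
    obtain ⟨d, hd⟩ := hadd a b c h1 h2 h3
    exact ⟨d, by simp only [x, hd, smul_add]⟩
  have xinj : Function.Injective x := (MulAction.injective N⁻¹).comp hinj
  obtain ⟨p, q, r, xk⟩ : ∃ p q r, x k = ![p, q, r] :=
    ⟨x k 0, x k 1, x k 2, by ext a; fin_cases a <;> rfl⟩
  -- `r = 1` would put `u k` into the affine plane through `u i`, `u j`, `u l`.
  have hr : r ≠ 1 := by
    rintro rfl
    apply hk
    have hkk : u i + u k = p • (u i + u j) + q • (u i + u l) := by
      have h := hN (x k)
      rw [hNx, xk] at h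
      simp only [Matrix.cons_val] at h
      linear_combination (norm := module) h + huu (u i)
    rw [hkk, map_add, map_smul, map_smul, triple_self_left, triple_self_right, smul_zero,
      smul_zero, add_zero]
  have hmem (t) : ∃ a, x a = cubePoint p q r t := by
    have key {a b c : ι} (h1 : a ≠ b) (h2 : a ≠ c) (h3 : b ≠ c) {y : Fin 3 → F}
        (hy : x a + x b + x c = y) : ∃ d, x d = y := by
      obtain ⟨d, hd⟩ := xadd a b c h1 h2 h3
      exact ⟨d, hd.trans hy⟩
    obtain ⟨_ | _, _ | _, _ | _⟩ := t
    · exact ⟨i, by simp [cubePoint, xi]⟩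
    · exact ⟨k, by simp [cubePoint, xk]⟩
    · exact ⟨l, by simp [cubePoint, xl]⟩
    · exact key hil hik hlk (by ext a; fin_cases a <;> simp [cubePoint, xi, xl, xk] <;> grind)
    · exact ⟨j, by simp [cubePoint, xj]⟩
    · exact key hij hik hjk (by ext a; fin_cases a <;> simp [cubePoint, xi, xj, xk] <;> grind)
    · exact key hij hil hjl (by
        ext a
        fin_cases a <;> simp [cubePoint, xi, xj, xl]
        grind)
    · exact key hjl hjk hlk (by ext a; fin_cases a <;> (simp [cubePoint, xj, xl, xk]; grind))
  choose f hf using hmem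
  have hfinj : Function.Injective f := fun s t hst =>
    cubePoint_injective hr (by rw [← hf s, ← hf t, hst])
  have hfsurj : Function.Surjective f :=
    ((Fintype.bijective_iff_injective_and_card f).2 ⟨hfinj, by rw [hcard]; rfl⟩).2
  refine ⟨(fun P : PG2 F => (Matrix.ProjGenLinGroup.mk N⁻¹ : PGL(3, F)) • P) '' K, ?_, _, rfl⟩
  refine isHomologyArc_of_cubePoint (p := p) (q := q) (r := r) hr (fun s t w h1 h2 h3 => ?_)
    fun P => ⟨?_, ?_⟩
  · rw [← hf, ← hf, ← hf]
    exact xarc _ _ _ (hfinj.ne h1) (hfinj.ne h2) (hfinj.ne h3)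
  · rintro ⟨Q, hQ, rfl⟩
    obtain ⟨a, ha, rfl⟩ := (hK Q).1 hQ
    obtain ⟨t, rfl⟩ := hfsurj a
    refine ⟨t, ?_, ?_⟩
    · rw [← hf t]; exact (smul_ne_zero_iff_ne N⁻¹).2 ha
    · simp only [Projectivization.PGL.mk_smul_mk, ← hf t, x]
  · rintro ⟨t, ht, rfl⟩
    have ha : u (f t) ≠ 0 := by
      rw [← hf t] at ht
      exact (smul_ne_zero_iff_ne N⁻¹).1 ht
    refine ⟨Projectivization.mk F _ ha, (hK _).2 ⟨f t, ha, rfl⟩, ?_⟩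
    simp only [Projectivization.PGL.mk_smul_mk, ← hf t, x]

end Classification

/-! ### Lines and collinearity in terms of representatives -/

section Lines

variable {F : Type*} [Field F]

theorem pair_indep_rep {P Q : PG2 F} (h : P ≠ Q) (s t : F)
    (hst : s • P.rep + t • Q.rep = 0) : s = 0 ∧ t = 0 :=
  LinearIndependent.pair_iff.1 (Projectivization.linearIndependent_pair_iff_ne.2 h) s t hst

theorem exists_rep_eq_of_triple_eq_zero {P Q R : PG2 F} (h : P ≠ Q)
    (h0 : triple P.rep Q.rep R.rep = 0) : ∃ s t : F, R.rep = s • P.rep + t • Q.rep :=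
  exists_eq_of_triple_eq_zero (pair_indep_rep h) h0

theorem mem_subspace_iff_rep {L : Projectivization.Subspace F (Fin 3 → F)} {P : PG2 F} :
    P ∈ L ↔ P.rep ∈ L.submodule := by
  rw [Projectivization.Subspace.mem_submodule_iff L P.rep_nonzero, P.mk_rep]

theorem isCollinear_triple_iff {P Q R : PG2 F} :
    Projectivization.IsCollinear ({P, Q, R} : Set (PG2 F)) ↔
      triple P.rep Q.rep R.rep = 0 := by
  constructor
  · rintro ⟨M, -, hM, hsub⟩
    by_contra hne
    have hli : LinearIndependent F ![P.rep, Q.rep, R.rep] :=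
      triple_ne_zero_iff_linearIndependent.1 hne
    have hle : Submodule.span F (Set.range ![P.rep, Q.rep, R.rep]) ≤ M.submodule := by
      rw [Submodule.span_le]
      rintro _ ⟨i, rfl⟩
      fin_cases i
      · exact mem_subspace_iff_rep.1 (hsub (by simp))
      · exact mem_subspace_iff_rep.1 (hsub (by simp))
      · exact mem_subspace_iff_rep.1 (hsub (by simp))
    have h3 := Submodule.finrank_mono hle
    rw [finrank_span_eq_card hli, Fintype.card_fin] at h3
    omega
  · intro h0
    have hli : ¬ LinearIndependent F ![P.rep, Q.rep, R.rep] := fun hli =>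
      triple_ne_zero_iff_linearIndependent.2 hli h0
    rw [linearIndependent_iff_card_le_finrank_span, Fintype.card_fin, Set.finrank] at hli
    refine ⟨(Submodule.span F (Set.range ![P.rep, Q.rep, R.rep])).projectivization, ?_, ?_, ?_⟩
    · infer_instance
    · rw [Projectivization.Subspace.submodule.apply_symm_apply]
      omega
    · intro X hX
      rw [SetLike.mem_coe, mem_subspace_iff_rep,
        Projectivization.Subspace.submodule.apply_symm_apply]
      rcases hX with rfl | rfl | rfl
      · exact Submodule.subset_span ⟨0, rfl⟩
      · exact Submodule.subset_span ⟨1, rfl⟩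
      · exact Submodule.subset_span ⟨2, rfl⟩

theorem exists_isLine_of_functional {φ : (Fin 3 → F) →ₗ[F] F} (hφ : φ ≠ 0) :
    ∃ L : Projectivization.Subspace F (Fin 3 → F), IsLine L ∧ ∀ P, P ∈ L ↔ φ P.rep = 0 := by
  refine ⟨(LinearMap.ker φ).projectivization, ?_, fun P => ?_⟩
  · rw [IsLine, Projectivization.Subspace.submodule.apply_symm_apply]
    have := Module.Dual.finrank_ker_add_one_of_ne_zero hφ
    rw [Module.finrank_fin_fun] at this
    omega
  · rw [mem_subspace_iff_rep, Projectivization.Subspace.submodule.apply_symm_apply,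
      LinearMap.mem_ker]

theorem triple_rep_ne_zero_of_ne {P Q : PG2 F} (h : P ≠ Q) : triple P.rep Q.rep ≠ 0 := by
  intro h0
  have hlt : Submodule.span F (Set.range ![P.rep, Q.rep]) < ⊤ := by
    refine lt_top_iff_ne_top.2 fun htop => ?_
    have := finrank_range_le_card (R := F) ![P.rep, Q.rep]
    rw [Set.finrank, htop, finrank_top, Module.finrank_fin_fun, Fintype.card_fin] at this
    omega
  obtain ⟨z, -, hz⟩ := SetLike.exists_of_lt hlt
  have hz' : triple P.rep Q.rep z = 0 := by rw [h0]; rfl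
  obtain ⟨s, t, rfl⟩ := exists_eq_of_triple_eq_zero (pair_indep_rep h) hz'
  exact hz (add_mem (Submodule.smul_mem _ _ (Submodule.subset_span ⟨0, rfl⟩))
    (Submodule.smul_mem _ _ (Submodule.subset_span ⟨1, rfl⟩)))

end Lines

/-! ### Arcs with a minimum blocking set -/

section Arcs

variable {F : Type*} [Field F] {K B : Set (PG2 F)}

/-- Counting secants through a point of the arc: a blocking set of minimum size has exactly one
point on each secant, and on each line joining a point of the arc with a point of the blocking set
there is exactly one further point of the arc. So the blocking set carries a `1`-factorization. -/
theorem exists_isFactoredArc [Finite F]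
    (harc : ∀ P ∈ K, ∀ Q ∈ K, ∀ R ∈ K, P ≠ Q → P ≠ R → Q ≠ R →
      ¬ Projectivization.IsCollinear ({P, Q, R} : Set (PG2 F)))
    (hB : IsMinimumBlockingSet K B) :
    ∃ m : B → K → K, IsFactoredArc (fun P : K => P.1.rep) m ∧
      ∀ (R : B) (P : K), ∃ x y : F, x ≠ 0 ∧ y ≠ 0 ∧ R.1.rep = x • P.1.rep + y • (m R P).1.rep := by
  classical
  obtain ⟨⟨hdisj, hmeet⟩, hcard⟩ := hB
  have : Fintype K := Fintype.ofFinite K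
  have : Fintype B := Fintype.ofFinite B
  have hne (P : K) (R : B) : P.1 ≠ R.1 := fun h => Set.disjoint_left.1 hdisj R.2 (h ▸ P.2)
  have hne3 (P Q S : K) (h1 : P ≠ Q) (h2 : P ≠ S) (h3 : Q ≠ S) :
      triple P.1.rep Q.1.rep S.1.rep ≠ 0 := fun h0 =>
    harc _ P.2 _ Q.2 _ S.2 (Subtype.coe_ne_coe.2 h1) (Subtype.coe_ne_coe.2 h2)
      (Subtype.coe_ne_coe.2 h3) (isCollinear_triple_iff.2 h0)
  have hblock (P : K) (Q : {Q : K // Q ≠ P}) : ∃ R : B, triple P.1.rep R.1.rep Q.1.1.rep = 0 := by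
    have hPQ : P.1 ≠ Q.1.1 := fun h => Q.2 (Subtype.ext h.symm)
    obtain ⟨L, hL, hmem⟩ := exists_isLine_of_functional (triple_rep_ne_zero_of_ne hPQ)
    obtain ⟨R, hR, hRL⟩ := hmeet L ⟨hL, _, P.2, _, Q.1.2, hPQ,
      (hmem _).2 (triple_self_left _ _), (hmem _).2 (triple_self_right _ _)⟩
    refine ⟨⟨R, hR⟩, ?_⟩
    rw [triple_swap_right, neg_eq_zero]
    exact (hmem R).1 hRL
  -- the line joining `P` to a point of `B` contains at most one further point of the arc
  have huniq (P : K) (R : B) (Q Q' : K) (hQ : Q ≠ P) (hQ' : Q' ≠ P)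
      (h1 : triple P.1.rep R.1.rep Q.1.rep = 0) (h2 : triple P.1.rep R.1.rep Q'.1.rep = 0) :
      Q = Q' := by
    by_contra hQQ
    obtain ⟨s, t, hs⟩ := exists_rep_eq_of_triple_eq_zero (hne P R) h1
    obtain ⟨s', t', hs'⟩ := exists_rep_eq_of_triple_eq_zero (hne P R) h2
    refine hne3 P Q Q' hQ.symm hQ'.symm hQQ ?_
    rw [hs, hs']
    simp only [triple_apply, Pi.add_apply, Pi.smul_apply, smul_eq_mul]
    ring
  choose c hc using hblock
  have hbij (P : K) : Function.Bijective (c P) := by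
    rw [Fintype.bijective_iff_injective_and_card]
    refine ⟨fun Q Q' h => Subtype.ext ?_, ?_⟩
    · exact huniq P (c P Q) Q.1 Q'.1 Q.2 Q'.2 (hc P Q) (h ▸ hc P Q')
    · rw [← Nat.card_coe_set_eq, ← Nat.card_coe_set_eq, Nat.card_eq_fintype_card,
        Nat.card_eq_fintype_card] at hcard
      rw [Fintype.card_subtype_compl, Fintype.card_subtype_eq]
      omega
  have hex (R : B) (P : K) : ∃ Q : K, Q ≠ P ∧ triple P.1.rep R.1.rep Q.1.rep = 0 := by
    obtain ⟨Q, rfl⟩ := (hbij P).2 R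
    exact ⟨Q.1, Q.2, hc P Q⟩
  choose m hm hm0 using hex
  have hmc (P : K) (R : B) (Q : K) (hQ : Q ≠ P) (h0 : triple P.1.rep R.1.rep Q.1.rep = 0) :
      R = c P ⟨Q, hQ⟩ := by
    obtain ⟨Q', rfl⟩ := (hbij P).2 R
    have := huniq P _ Q'.1 Q Q'.2 hQ (hc P Q') h0
    subst this
    rfl
  refine ⟨m, ⟨hne3, fun P Q h => pair_indep_rep (Subtype.coe_ne_coe.2 h), fun R P => ?_,
    fun R P => hm R P, fun P Q hPQ => ⟨c P ⟨Q, hPQ.symm⟩, ?_, fun R hR => ?_⟩⟩, fun R P => ?_⟩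
  · refine huniq (m R P) R _ _ (hm R _) (hm R P).symm (hm0 R _) ?_
    rw [triple_rotate, triple_swap, hm0, neg_zero]
  · exact huniq P _ _ _ (hm _ P) hPQ.symm (hm0 _ P) (hc P ⟨Q, hPQ.symm⟩)
  · subst hR
    exact hmc P R _ _ (hm0 R P)
  · have h0 : triple P.1.rep (m R P).1.rep R.1.rep = 0 := by
      rw [triple_swap_right, hm0, neg_zero]
    obtain ⟨x, y, hxy⟩ := exists_rep_eq_of_triple_eq_zero
      (Subtype.coe_ne_coe.2 (hm R P).symm) h0
    refine ⟨x, y, ?_, ?_, hxy⟩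
    · rintro rfl
      have := pair_indep_rep (hne (m R P) R) y (-1) (by rw [hxy]; module)
      exact one_ne_zero (neg_eq_zero.1 this.2)
    · rintro rfl
      have := pair_indep_rep (hne P R) x (-1) (by rw [hxy]; module)
      exact one_ne_zero (neg_eq_zero.1 this.2)

theorem exists_functional_ne_zero_of_not_isLinear (hlin : ¬ IsLinear B)
    {φ : (Fin 3 → F) →ₗ[F] F} (hφ : φ ≠ 0) : ∃ R : B, φ R.1.rep ≠ 0 := by
  by_contra! h
  obtain ⟨L, hL, hmem⟩ := exists_isLine_of_functional hφ
  exact hlin ⟨L, hL, fun P hP => (hmem P).2 (h ⟨P, hP⟩)⟩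

theorem two_lt_ncard_of_not_isLinear [Finite F] (hlin : ¬ IsLinear B) : 2 < B.ncard := by
  have : Fintype B := Fintype.ofFinite B
  by_contra! hle
  have hlt : Submodule.span F (Set.range fun R : B => R.1.rep) < ⊤ := by
    refine lt_top_iff_ne_top.2 fun htop => ?_
    have := finrank_range_le_card (R := F) fun R : B => R.1.rep
    rw [Set.finrank, htop, finrank_top, Module.finrank_fin_fun, ← Nat.card_eq_fintype_card,
      Nat.card_coe_set_eq] at this
    omega
  obtain ⟨φ, hφ, hker⟩ := Submodule.exists_le_ker_of_lt_top _ hlt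
  obtain ⟨R, hR⟩ := exists_functional_ne_zero_of_not_isLinear hlin hφ
  exact hR (hker (Submodule.subset_span ⟨R, rfl⟩))

/-- The part of the argument common to blocking sets and embedded `1`-factorizations: an arc with at
most ten points and a non-linear blocking set of minimum size is an eight-point homology arc. -/
theorem ncard_eq_eight_and_projEquiv_of_not_isLinear [Finite F] [CharP F 2]
    (harc : ∀ P ∈ K, ∀ Q ∈ K, ∀ R ∈ K, P ≠ Q → P ≠ R → Q ≠ R →
      ¬ Projectivization.IsCollinear ({P, Q, R} : Set (PG2 F)))
    (hK : K.ncard ≤ 10) (hB : IsMinimumBlockingSet K B) (hlin : ¬ IsLinear B) :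
    K.ncard = 8 ∧ ∃ K', IsHomologyArc K' ∧ ProjEquiv K K' := by
  classical
  have : Fintype K := Fintype.ofFinite K
  have : Fintype B := Fintype.ofFinite B
  have hcard := hB.2
  have hB3 := two_lt_ncard_of_not_isLinear hlin
  have hKc : K.ncard = Fintype.card K := by
    rw [← Nat.card_coe_set_eq, Nat.card_eq_fintype_card]
  rw [hKc] at hK hcard ⊢
  obtain ⟨m, hm, hb⟩ := exists_isFactoredArc harc hB
  obtain ⟨A, hA, hs⟩ := hm.exists_scaling (b := fun R : B => R.1.rep) hb
  have hu := hm.smul hA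
  have key := fun i j l => hu.card_eq_eight_and_exists_add (i := i) (j := j) (l := l) hs
    (fun φ => exists_functional_ne_zero_of_not_isLinear hlin) hK
  obtain ⟨i, j, l, hij, hil, hjl⟩ := Fintype.two_lt_card_iff.1 (by omega : 2 < Fintype.card K)
  have h8 := (key i j l hij hil hjl).1
  refine ⟨h8, ?_⟩
  set u : K → Fin 3 → F := fun i => A i • i.1.rep with hudef
  have hφ : triple (u i + u j) (u i + u l) ≠ 0 := by
    intro h0
    have h1 : triple (u i + u j) (u i + u l) (u i) = triple (u j) (u l) (u i) := by
      simp only [triple_apply, Pi.add_apply]; ring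
    rw [h0] at h1
    exact hu.triple_ne_zero j l i hjl hij.symm hil.symm h1.symm
  obtain ⟨R, hR⟩ := exists_functional_ne_zero_of_not_isLinear hlin hφ
  obtain ⟨s, -, hsR⟩ := hs R i
  refine exists_projEquiv_isHomologyArc hu.injective h8 hu.triple_ne_zero
    (fun i j l h1 h2 h3 => (key i j l h1 h2 h3).2) hij hil hjl (k := m R i) ?_ fun P => ?_
  · rw [hsR, map_smul] at hR
    exact right_ne_zero_of_mul hR
  · have hmk (i : K) (h : u i ≠ 0) : Projectivization.mk F (u i) h = i.1 := by
      rw [← i.1.mk_rep, Projectivization.mk_eq_mk_iff']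
      exact ⟨A i, rfl⟩
    constructor
    · intro hP
      have h0 : u ⟨P, hP⟩ ≠ 0 := smul_ne_zero (hA _) P.rep_nonzero
      exact ⟨⟨P, hP⟩, h0, (hmk _ h0).symm⟩
    · rintro ⟨i, h, rfl⟩
      rw [hmk]
      exact i.2

end Arcs

/-! ### Embedded one-factorizations -/

section OneFactorizations

variable {V : Type*} {𝓕 : Set (SimpleGraph.completeGraph V).Subgraph}

/-- The factors are in bijection with the vertices other than a given one. -/
theorem IsOneFactorization.card_add_one [Finite V] [Nonempty V] (h : IsOneFactorization 𝓕) :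
    Nat.card 𝓕 + 1 = Nat.card V := by
  classical
  obtain ⟨hpm, hdisj, hcov⟩ := h
  obtain ⟨a⟩ := ‹Nonempty V›
  have hex (M : 𝓕) : ∃! w, M.1.Adj a w := (hpm M.1 M.2).1 ((hpm M.1 M.2).2 a)
  choose p hp' hpu using hex
  have hp (M : 𝓕) : M.1.Adj a (p M) := hp' M
  have hbij : Function.Bijective fun M : 𝓕 => (⟨p M, (M.1.adj_sub (hp M)).ne'⟩ : {w : V // w ≠ a}) := by
    constructor
    · intro M N hMN
      by_contra hne
      have hMN' : p M = p N := congrArg Subtype.val hMN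
      have hM : s(a, p M) ∈ M.1.edgeSet := hp M
      have hN : s(a, p M) ∈ N.1.edgeSet := hMN' ▸ hp N
      exact Set.disjoint_left.1 (hdisj M.1 M.2 N.1 N.2 (Subtype.coe_ne_coe.2 hne)) hM hN
    · rintro ⟨w, hw⟩
      obtain ⟨M, hM, hMe⟩ := hcov s(a, w) (by simpa using hw.symm)
      exact ⟨⟨M, hM⟩, Subtype.ext (hpu ⟨M, hM⟩ w hMe).symm⟩
  have := Fintype.ofFinite V
  rw [Nat.card_eq_of_bijective _ hbij, Nat.card_eq_fintype_card, Nat.card_eq_fintype_card,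
    Fintype.card_subtype_compl, Fintype.card_subtype_eq]
  have : 0 < Fintype.card V := Fintype.card_pos_iff.2 ⟨a⟩
  omega

/-- The points of the factors of an embedded `1`-factorization form a blocking set of minimum size
of the secants of the arc formed by the points of the vertices. -/
theorem IsEmbedding.isMinimumBlockingSet {F : Type*} [Field F] [Finite V] [Nonempty V]
    (h : IsOneFactorization 𝓕) {ψ : V ⊕ 𝓕 → PG2 F} (hψ : IsEmbedding 𝓕 ψ) :
    IsMinimumBlockingSet (Set.range fun i => ψ (Sum.inl i))
      (Set.range fun M : 𝓕 => ψ (Sum.inr M)) := by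
  refine ⟨⟨?_, ?_⟩, ?_⟩
  · rw [Set.disjoint_left]
    rintro _ ⟨M, rfl⟩ ⟨i, hi⟩
    exact Sum.inl_ne_inr (hψ.1 hi)
  · rintro L ⟨-, _, ⟨i, rfl⟩, _, ⟨j, rfl⟩, hne, hi, hj⟩
    have hij : i ≠ j := by rintro rfl; exact hne rfl
    obtain ⟨M, hM, hMe⟩ := h.2.2 s(i, j) (by simpa using hij)
    refine ⟨_, ⟨⟨M, hM⟩, rfl⟩, ?_⟩
    have h0 := isCollinear_triple_iff.1 (hψ.2.2 ⟨M, hM⟩ i j hMe)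
    rw [triple_rotate] at h0
    obtain ⟨s, t, hst⟩ := exists_rep_eq_of_triple_eq_zero hne h0
    rw [mem_subspace_iff_rep] at hi hj ⊢
    rw [hst]
    exact add_mem (Submodule.smul_mem _ _ hi) (Submodule.smul_mem _ _ hj)
  · rw [← Nat.card_coe_set_eq, ← Nat.card_coe_set_eq,
      Nat.card_range_of_injective (f := fun i => ψ (Sum.inl i)) (hψ.1.comp Sum.inl_injective),
      Nat.card_range_of_injective (f := fun M : 𝓕 => ψ (Sum.inr M))
        (hψ.1.comp Sum.inr_injective), h.card_add_one]

end OneFactorizations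

end HyperfocusedArc

theorem theorem5p1 {F : Type*} [Field F] [Finite F] (hq : Even (Nat.card F)) :
    (∀ (k : ℕ) (K : Set (HyperfocusedArc.PG2 F)), HyperfocusedArc.IsArc k K → k ≤ 10 →
      (∃ B : Set (HyperfocusedArc.PG2 F),
        HyperfocusedArc.IsMinimumBlockingSet K B ∧ ¬ HyperfocusedArc.IsLinear B) →
      k = 8 ∧ ∃ K' : Set (HyperfocusedArc.PG2 F),
        HyperfocusedArc.IsHomologyArc K' ∧ HyperfocusedArc.ProjEquiv K K') ∧
    (∀ n : ℕ, 3 ≤ n → n ≤ 5 →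
      ∀ 𝓕 : Set (SimpleGraph.completeGraph (Fin (2 * n))).Subgraph, HyperfocusedArc.IsOneFactorization 𝓕 →
      ∀ ψ : Fin (2 * n) ⊕ 𝓕 → HyperfocusedArc.PG2 F, HyperfocusedArc.IsEmbedding 𝓕 ψ →
      ¬ HyperfocusedArc.IsLinear (Set.range fun M : 𝓕 => ψ (Sum.inr M)) →
      n = 4 ∧ ∃ K' : Set (HyperfocusedArc.PG2 F),
        HyperfocusedArc.IsHomologyArc K' ∧
          HyperfocusedArc.ProjEquiv (Set.range fun i => ψ (Sum.inl i)) K') := by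
  have := Fintype.ofFinite F
  have : CharP F 2 := by
    rw [Nat.card_eq_fintype_card, Nat.even_iff, ← FiniteField.even_card_iff_char_two] at hq
    exact ringChar.of_eq hq
  constructor
  · rintro k K ⟨rfl, harc⟩ hk ⟨B, hB, hlin⟩
    exact HyperfocusedArc.ncard_eq_eight_and_projEquiv_of_not_isLinear harc hk hB hlin
  · intro n h3 h5 𝓕 h𝓕 ψ hψ hlin
    have : Nonempty (Fin (2 * n)) := ⟨⟨0, by omega⟩⟩
    have hcard : (Set.range fun i => ψ (Sum.inl i)).ncard = 2 * n := by
      rw [← Nat.card_coe_set_eq, Nat.card_range_of_injective (f := fun i => ψ (Sum.inl i))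
        (hψ.1.comp Sum.inl_injective), Nat.card_fin]
    have key := HyperfocusedArc.ncard_eq_eight_and_projEquiv_of_not_isLinear
      (K := Set.range fun i => ψ (Sum.inl i)) ?_ (by omega) (hψ.isMinimumBlockingSet h𝓕) hlin
    · exact ⟨by omega, key.2⟩
    · rintro _ ⟨i, rfl⟩ _ ⟨j, rfl⟩ _ ⟨l, rfl⟩ h1 h2 h3
      exact hψ.2.1 i j l (fun h => h1 (h ▸ rfl)) (fun h => h2 (h ▸ rfl)) fun h => h3 (h ▸ rfl)
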